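/- A neural network $\Phi$ with input dimension $n$ and output dimension $k$ is a finite sequence $((A_1,b_1),\dots,(A_L,b_L))$, $L\ge 1$, of matrices $A_\ell\in\mathbb{R}^{N_\ell\times N_{\ell-1}}$ and vectors $b_\ell\in\mathbb{R}^{N_\ell}$ with $N_0=n$, $N_L=k$ and all $N_\ell\ge 1$. Its ReLU realization $\mathrm{R}(\Phi):\mathbb{R}^n\to\mathbb{R}^k$ is $x\mapsto x_L$, where $x_0=x$, $x_\ell=\varrho(A_\ell x_{\ell-1}+b_\ell)$ for $1\le\ell\le L-1$, with $\varrho(t)=\max\{t,0\}$ acting componentwise, and $x_L=A_Lx_{L-1}+b_L$. Let $L(\Phi)=L$ be its number of layers, and let $M(\Phi)$, its number of weights, be the total number of nonzero entries of all $A_\ell$ and $b_\ell$. For $A\in\mathbb{R}^{d\times d}$ let $\mathrm{vec}(A)\in\mathbb{R}^{d^2}$ be the vector obtained by stacking the columns of $A$, let $\mathrm{matr}$ be the inverse of $\mathrm{vec}$, and let $\|A\|_2$ be the spectral norm. For $\varepsilon,\delta\in(0,1)$ put $$m(\varepsilon,\delta)=\left\lceil\frac{\log_2(0.5\,\varepsilon\delta)}{\log_2(1-\delta)}\right\rceil-1,\qquad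 \bar m=\bar m(\varepsilon,\delta)=\max\{m(\varepsilon,\delta),2\}.$$ **Theorem.** There is a universal constant $C>0$ such that for every integer $d\ge1$, every $\varepsilon\in(0,1/4)$ and every $\delta\in(0,1)$ there is a neural network $\Phi$ with $d^2$-dimensional input and $d^2$-dimensional output such that 1. $L(\Phi)\le C\log_2(\bar m)\,\bigl(\log_2(1/\varepsilon)+\log_2(\bar m)+\log_2(d)\bigr)$; 2. $M(\Phi)\le C\,\bar m\,\log_2^2(\bar m)\,d^3\,\bigl(\log_2(1/\varepsilon)+\log_2(\bar m)+\log_2(d)\bigr)$; 3. for every $A\in\mathbb{R}^{d\times d}$ with $\|A\|_2\le 1-\delta$ the matrix $\mathrm{Id}-A$ is invertible and $\bigl\|(\mathrm{Id}-A)^{-1}-\mathrm{matr}\bigl(\mathrm{R}(\Phi)(\mathrm{vec}(A))\bigr)\bigr\|_2\le\varepsilon$; 4. for every such $A$, $\bigl\|\mathrm{matr}\bigl(\mathrm{R}(\Phi)(\mathrm{vec}(A))\bigr)\bigr\|_2\le\varepsilon+\|(\mathrm{Id}-A)^{-1}\|_2\le\varepsilon+\dfrac1{1-\|A\|_2}\le\varepsilon+\dfrac1\delta$.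 -/

import Mathlib

-- In this scope the norm of a real matrix is its spectral norm (the `ℓ²` operator norm).
open scoped Matrix Matrix.Norms.L2Operator

/-- Neural networks with `n`-dimensional input and `k`-dimensional output: nonempty finite sequences
`((A₁, b₁), …, (A_L, b_L))` of matrix-vector pairs with matching dimensions, all of them positive.
`output` is a network with one layer, and `cons` puts a further first layer in front. -/
inductive NeuralNetwork : ℕ → ℕ → Type
  | output {n k : ℕ} (hn : 0 < n) (hk : 0 < k)
      (A : Matrix (Fin k) (Fin n) ℝ) (b : Fin k → ℝ) : NeuralNetwork n k
  | cons {n h k : ℕ} (hn : 0 < n)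
      (A : Matrix (Fin h) (Fin n) ℝ) (b : Fin h → ℝ) (Φ : NeuralNetwork h k) : NeuralNetwork n k

noncomputable section

namespace NeuralNetwork

/-- The realization with activation function `ϱ`: the activation is applied componentwise after
every layer except the last one. -/
def realize (ϱ : ℝ → ℝ) : {n k : ℕ} → NeuralNetwork n k → (Fin n → ℝ) → (Fin k → ℝ)
  | _, _, output _ _ A b, x => A *ᵥ x + b
  | _, _, cons _ A b Φ, x => realize ϱ Φ (fun i => ϱ ((A *ᵥ x + b) i))

/-- The number `L(Φ)` of layers. -/
def numLayers : {n k : ℕ} → NeuralNetwork n k → ℕ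
  | _, _, output _ _ _ _ => 1
  | _, _, cons _ _ _ Φ => numLayers Φ + 1

/-- The number `‖A‖₀ + ‖b‖₀` of nonzero entries of the pair `(A, b)`. -/
def layerWeights {n k : ℕ} (A : Matrix (Fin k) (Fin n) ℝ) (b : Fin k → ℝ) : ℕ :=
  (Finset.univ.filter fun p : Fin k × Fin n => A p.1 p.2 ≠ 0).card
    + (Finset.univ.filter fun i : Fin k => b i ≠ 0).card

/-- The number `M(Φ)` of weights: the nonzero entries of all matrices and vectors of `Φ`. -/
def numWeights : {n k : ℕ} → NeuralNetwork n k → ℕ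
  | _, _, output _ _ A b => layerWeights A b
  | _, _, cons _ A b Φ => layerWeights A b + numWeights Φ

end NeuralNetwork

/-- The ReLU activation function. -/
def relu (x : ℝ) : ℝ := max x 0

/-- The column-by-column vectorization of a `d × d` matrix: the entry `A i j` is put at
position `i + d * j` (counting from `0`). -/
def vecMatrix {d : ℕ} (A : Matrix (Fin d) (Fin d) ℝ) : Fin (d * d) → ℝ :=
  fun k => A (finProdFinEquiv.symm k).2 (finProdFinEquiv.symm k).1

/-- The inverse of `vecMatrix`. -/
def matrOfVec {d : ℕ} (v : Fin (d * d) → ℝ) : Matrix (Fin d) (Fin d) ℝ :=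
  Matrix.of fun i j => v (finProdFinEquiv (j, i))

/-- The truncation length `m(ε, δ) = ⌈log₂(0.5 ε δ) / log₂(1 - δ)⌉ - 1`, an integer. -/
def neumannLength (ε δ : ℝ) : ℤ :=
  ⌈Real.logb 2 (0.5 * ε * δ) / Real.logb 2 (1 - δ)⌉ - 1

end

/-! The truncated Neumann series of length `2 ^ K` is obtained by repeated squaring of one matrix:
the `2 ^ K`-th power of `[[A, t], [0, 1]]` has `t` times that partial sum as its upper right block
(`neumannBlock_pow`). With `t = 1 / 2 ^ K` all powers used have spectral norm at most 3, so `K`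
squarings stay in a fixed ball and the block is multiplied by `2 ^ K` only at the end.

A ReLU network squares a matrix through its scalar products. Polarization writes `x * y` as a
difference of values of `t * (1 - t)`, and iterating the sawtooth `hat` computes `4 ^ n * (t * (1 -
t))` up to a remainder in `[0, 1/4]`. Hence `n` layers give error of order `4 ^ (-n)`. Entries are
stored as `x / B + 1`, which is nonnegative, so that ReLU does not alter them.

A squaring multiplies the inherited error by at most 7 and adds a new one
(`exists_squareBlock_iterate`). The total loss `16 ^ K`, the dimension factors and `1 / ε` enter `n`
only through logarithms. With `K` of order `log₂ m̄`, depth is about `K * n` and size about `K * n *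
d ^ 3`. -/

/-! ### Sparse layers and composition of networks -/

/-- The affine map whose `i`-th output is `∑ s, c i s * x (idx i s) + b i`. -/
def sparseAffine {ι κ S : Type} [Fintype S] (idx : κ → S → ι) (c : κ → S → ℝ) (b : κ → ℝ)
    (x : ι → ℝ) : κ → ℝ :=
  fun i => ∑ s, c i s * x (idx i s) + b i

/-- A sparse affine map followed by the componentwise ReLU. -/
noncomputable def sparseLayer {ι κ S : Type} [Fintype S] (idx : κ → S → ι) (c : κ → S → ℝ)
    (b : κ → ℝ) (x : ι → ℝ) : κ → ℝ :=
  fun i => relu (sparseAffine idx c b x i)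

/-- The matrix of the linear part of a sparse affine map. -/
def sparseMatrix {S : Type} [Fintype S] {n k : ℕ} (idx : Fin k → S → Fin n)
    (c : Fin k → S → ℝ) : Matrix (Fin k) (Fin n) ℝ :=
  Matrix.of fun i j => ∑ s, if idx i s = j then c i s else 0

theorem sparseMatrix_mulVec_add {S : Type} [Fintype S] {n k : ℕ} (idx : Fin k → S → Fin n)
    (c : Fin k → S → ℝ) (b : Fin k → ℝ) (x : Fin n → ℝ) :
    sparseMatrix idx c *ᵥ x + b = sparseAffine idx c b x := by
  ext i
  simp only [sparseMatrix, sparseAffine, Matrix.mulVec, dotProduct, Pi.add_apply, Matrix.of_apply,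
    Finset.sum_mul, ite_mul, zero_mul]
  rw [Finset.sum_comm]
  simp

theorem layerWeights_sparseMatrix_le {S : Type} [Fintype S] {n k : ℕ} (idx : Fin k → S → Fin n)
    (c : Fin k → S → ℝ) (b : Fin k → ℝ) :
    NeuralNetwork.layerWeights (sparseMatrix idx c) b ≤ k * (Fintype.card S + 1) := by
  classical
  have h1 : (Finset.univ.filter fun p : Fin k × Fin n => sparseMatrix idx c p.1 p.2 ≠ 0).card
      ≤ k * Fintype.card S := by
    calc _ ≤ ((Finset.univ : Finset (Fin k × S)).image fun q => (q.1, idx q.1 q.2)).card := by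
          apply Finset.card_le_card
          rintro ⟨i, j⟩ hp
          obtain ⟨s, -, hs⟩ := Finset.exists_ne_zero_of_sum_ne_zero (Finset.mem_filter.1 hp).2
          have hs' : idx i s = j := by
            by_contra h
            exact hs (if_neg h)
          exact Finset.mem_image.2 ⟨(i, s), Finset.mem_univ _, by rw [← hs']⟩
      _ ≤ _ := Finset.card_image_le
      _ = _ := by simp
  have h2 : (Finset.univ.filter fun i : Fin k => b i ≠ 0).card ≤ k :=
    (Finset.card_le_univ _).trans (by simp)
  rw [NeuralNetwork.layerWeights, mul_add, mul_one]
  exact add_le_add h1 h2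

/-- The function `f` is the ReLU realization of a network with at most `L` layers and at most `M`
weights, for every numbering of the coordinates. -/
def HasReluNetwork {ι κ : Type} (f : (ι → ℝ) → κ → ℝ) (L M : ℕ) : Prop :=
  ∀ (n k : ℕ) (e : ι ≃ Fin n) (e' : κ ≃ Fin k), ∃ Φ : NeuralNetwork n k,
    Φ.numLayers ≤ L ∧ Φ.numWeights ≤ M ∧
      ∀ x : ι → ℝ, Φ.realize relu (x ∘ e.symm) = f x ∘ e'.symm

theorem hasReluNetwork_sparseAffine {ι κ S : Type} [Nonempty ι] [Nonempty κ] [Fintype κ]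
    [Fintype S] (idx : κ → S → ι) (c : κ → S → ℝ) (b : κ → ℝ) :
    HasReluNetwork (sparseAffine idx c b) 1 (Fintype.card κ * (Fintype.card S + 1)) := by
  intro n k e e'
  have hn : 0 < n := Fin.pos (e (Classical.arbitrary ι))
  have hk : 0 < k := Fin.pos (e' (Classical.arbitrary κ))
  refine ⟨.output hn hk (sparseMatrix (fun i s => e (idx (e'.symm i) s)) fun i => c (e'.symm i))
    (b ∘ e'.symm), le_rfl, ?_, fun x => ?_⟩
  · rw [Fintype.card_congr e', Fintype.card_fin]
    exact layerWeights_sparseMatrix_le _ _ _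
  · rw [NeuralNetwork.realize, sparseMatrix_mulVec_add]
    ext i
    simp [sparseAffine]

/-- Since `HasReluNetwork` allows every numbering, any numbering of the intermediate coordinates
serves to put the new layer in front. -/
theorem HasReluNetwork.comp_sparseLayer {ι κ ν S : Type} [Nonempty ι] [Fintype κ] [Fintype S]
    {f : (κ → ℝ) → ν → ℝ} {L M : ℕ} (hf : HasReluNetwork f L M) (idx : κ → S → ι)
    (c : κ → S → ℝ) (b : κ → ℝ) :
    HasReluNetwork (f ∘ sparseLayer idx c b) (L + 1)
      (M + Fintype.card κ * (Fintype.card S + 1)) := by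
  intro n k e e'
  have hn : 0 < n := Fin.pos (e (Classical.arbitrary ι))
  let g := Fintype.equivFin κ
  obtain ⟨Φ, hL, hM, hΦ⟩ := hf _ k g e'
  refine ⟨.cons hn (sparseMatrix (fun i s => e (idx (g.symm i) s)) fun i => c (g.symm i))
    (b ∘ g.symm) Φ, Nat.succ_le_succ hL, ?_, fun x => ?_⟩
  · rw [NeuralNetwork.numWeights, add_comm]
    exact add_le_add hM (layerWeights_sparseMatrix_le _ _ _)
  · rw [NeuralNetwork.realize, sparseMatrix_mulVec_add, Function.comp_apply, ← hΦ]
    congr 1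
    ext i
    simp [sparseLayer, sparseAffine]

theorem HasReluNetwork.comp_iterate {ι ν : Type} {g : (ι → ℝ) → ι → ℝ} {l w : ℕ}
    (hg : ∀ {f : (ι → ℝ) → ν → ℝ} {L M : ℕ}, HasReluNetwork f L M →
      HasReluNetwork (f ∘ g) (L + l) (M + w))
    {f : (ι → ℝ) → ν → ℝ} {L M : ℕ} (hf : HasReluNetwork f L M) (n : ℕ) :
    HasReluNetwork (f ∘ g^[n]) (L + n * l) (M + n * w) := by
  induction n with
  | zero => simpa using hf
  | succ n ih =>
    rw [Function.iterate_succ, ← Function.comp_assoc, Nat.succ_mul, Nat.succ_mul, ← add_assoc,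
      ← add_assoc]
    exact hg ih

/-! ### Spectral norm estimates, block matrices and the Neumann series -/

section MatrixNorm

variable {m : Type} [Fintype m] [DecidableEq m]

theorem Matrix.abs_apply_le_l2_opNorm (A : Matrix m m ℝ) (i j : m) : |A i j| ≤ ‖A‖ := by
  have h := Matrix.l2_opNorm_mulVec A (EuclideanSpace.single j 1)
  have h2 := PiLp.norm_apply_le ((EuclideanSpace.equiv m ℝ).symm (A *ᵥ (EuclideanSpace.single j (1:ℝ)).ofLp)) i
  simp only [PiLp.norm_single, norm_one, mul_one] at h
  refine le_trans (le_of_eq ?_) (h2.trans h)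
  simp [Real.norm_eq_abs]

theorem Matrix.l2_opNorm_single_le {n : Type} [Fintype n] [DecidableEq n] (i : m) (j : n) (c : ℝ) :
    ‖(Matrix.single i j c : Matrix m n ℝ)‖ ≤ |c| := by
  have h := Matrix.l2_opNorm_conjTranspose_mul_self (Matrix.single i j c : Matrix m n ℝ)
  have h1 : (Matrix.single i j c : Matrix m n ℝ)ᴴ * Matrix.single i j c
      = Matrix.diagonal (Pi.single j (c * c)) := by
    rw [Matrix.conjTranspose_single, Matrix.single_mul_single_same, Matrix.diagonal_single]
    simp
  rw [h1, Matrix.l2_opNorm_diagonal, Pi.norm_single] at h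
  rw [norm_mul] at h
  exact le_of_eq (mul_self_inj (norm_nonneg _) (abs_nonneg _) |>.1 h.symm)

/-- The triangle inequality over matrix units is crude, but a polynomial factor in the dimension
costs only `log₂ d` further layers per squaring. -/
theorem Matrix.l2_opNorm_le_of_abs_le (A : Matrix m m ℝ) {c : ℝ} (hA : ∀ i j, |A i j| ≤ c) :
    ‖A‖ ≤ (Fintype.card m : ℝ) ^ 2 * c := by
  conv_lhs => rw [Matrix.matrix_eq_sum_single A]
  calc _ ≤ ∑ i : m, ∑ j : m, c := by
        refine (norm_sum_le _ _).trans (Finset.sum_le_sum fun i _ => ?_)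
        refine (norm_sum_le _ _).trans (Finset.sum_le_sum fun j _ => ?_)
        exact (Matrix.l2_opNorm_single_le i j _).trans (hA i j)
    _ = _ := by simp; ring

/-- Only an inequality, because the index type may be empty. -/
theorem Matrix.l2_opNorm_one_le : ‖(1 : Matrix m m ℝ)‖ ≤ 1 := by
  rw [← Matrix.diagonal_one, Matrix.l2_opNorm_diagonal]
  exact (pi_norm_le_iff_of_nonneg zero_le_one).2 fun i => by simp

theorem Matrix.l2_opNorm_pow_le_one {A : Matrix m m ℝ} (hA : ‖A‖ ≤ 1) (n : ℕ) : ‖A ^ n‖ ≤ 1 := by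
  induction n with
  | zero => simpa using Matrix.l2_opNorm_one_le
  | succ n ih =>
    rw [pow_succ]
    exact (norm_mul_le _ _).trans (mul_le_one₀ ih (norm_nonneg _) hA)

theorem Matrix.l2_opNorm_fromRows_one_zero_le :
    ‖(Matrix.fromRows 1 0 : Matrix (m ⊕ m) m ℝ)‖ ≤ 1 := by
  have h := Matrix.l2_opNorm_conjTranspose_mul_self (Matrix.fromRows 1 0 : Matrix (m ⊕ m) m ℝ)
  rw [Matrix.conjTranspose_fromRows_eq_fromCols_conjTranspose, Matrix.fromCols_mul_fromRows] at h
  simp only [Matrix.conjTranspose_one, mul_one, Matrix.mul_zero, add_zero] at h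
  have := Matrix.l2_opNorm_one_le (m := m)
  nlinarith [norm_nonneg (Matrix.fromRows 1 0 : Matrix (m ⊕ m) m ℝ)]

theorem Matrix.l2_opNorm_fromRows_zero_one_le :
    ‖(Matrix.fromRows 0 1 : Matrix (m ⊕ m) m ℝ)‖ ≤ 1 := by
  have h := Matrix.l2_opNorm_conjTranspose_mul_self (Matrix.fromRows 0 1 : Matrix (m ⊕ m) m ℝ)
  rw [Matrix.conjTranspose_fromRows_eq_fromCols_conjTranspose, Matrix.fromCols_mul_fromRows] at h
  simp only [Matrix.conjTranspose_one, mul_one, Matrix.mul_zero, zero_add] at h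
  have := Matrix.l2_opNorm_one_le (m := m)
  nlinarith [norm_nonneg (Matrix.fromRows 0 1 : Matrix (m ⊕ m) m ℝ)]

theorem Matrix.l2_opNorm_mul_mul_conjTranspose_le {n : Type} [Fintype n] [DecidableEq n]
    {U V : Matrix n m ℝ} (hU : ‖U‖ ≤ 1) (hV : ‖V‖ ≤ 1) (A : Matrix m m ℝ) :
    ‖U * A * Vᴴ‖ ≤ ‖A‖ := by
  rw [← Matrix.l2_opNorm_conjTranspose] at hV
  calc ‖U * A * Vᴴ‖ ≤ ‖U‖ * ‖A‖ * ‖Vᴴ‖ :=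
        (Matrix.l2_opNorm_mul _ _).trans
          (mul_le_mul_of_nonneg_right (Matrix.l2_opNorm_mul _ _) (norm_nonneg _))
    _ ≤ 1 * ‖A‖ * 1 := by gcongr
    _ = ‖A‖ := by ring

theorem Matrix.l2_opNorm_fromBlocks_zero_one_le (A B : Matrix m m ℝ) :
    ‖Matrix.fromBlocks A B 0 (1 : Matrix m m ℝ)‖ ≤ ‖A‖ + ‖B‖ + 1 := by
  -- Each block is moved into place by the embeddings of the two summands, which have norm at most
  -- 1.
  have h : Matrix.fromBlocks A B 0 (1 : Matrix m m ℝ)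
      = (Matrix.fromRows 1 0 : Matrix (m ⊕ m) m ℝ) * A * (Matrix.fromRows 1 0 : Matrix (m ⊕ m) m ℝ)ᴴ
        + (Matrix.fromRows 1 0 : Matrix (m ⊕ m) m ℝ) * B * (Matrix.fromRows 0 1 : Matrix (m ⊕ m) m ℝ)ᴴ
        + (Matrix.fromRows 0 1 : Matrix (m ⊕ m) m ℝ) * (1 : Matrix m m ℝ) * (Matrix.fromRows 0 1 : Matrix (m ⊕ m) m ℝ)ᴴ := by
    simp only [Matrix.conjTranspose_fromRows_eq_fromCols_conjTranspose, Matrix.fromRows_mul]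
    ext (i | i) (j | j) <;> simp
  rw [h]
  have h1 := Matrix.l2_opNorm_fromRows_one_zero_le (m := m)
  have h2 := Matrix.l2_opNorm_fromRows_zero_one_le (m := m)
  refine (norm_add_le _ _).trans (add_le_add ((norm_add_le _ _).trans (add_le_add ?_ ?_)) ?_)
  · exact Matrix.l2_opNorm_mul_mul_conjTranspose_le h1 h1 A
  · exact Matrix.l2_opNorm_mul_mul_conjTranspose_le h1 h2 B
  · exact (Matrix.l2_opNorm_mul_mul_conjTranspose_le h2 h2 1).trans Matrix.l2_opNorm_one_le

theorem Matrix.l2_opNorm_toBlocks₁₂_le (X : Matrix (m ⊕ m) (m ⊕ m) ℝ) : ‖X.toBlocks₁₂‖ ≤ ‖X‖ := by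
  have h : X.toBlocks₁₂
      = (Matrix.fromRows 1 0 : Matrix (m ⊕ m) m ℝ)ᴴ * X
        * (Matrix.fromRows 0 1 : Matrix (m ⊕ m) m ℝ) := by
    rw [Matrix.conjTranspose_fromRows_eq_fromCols_conjTranspose]
    conv_rhs => rw [← Matrix.fromBlocks_toBlocks X]
    rw [Matrix.mul_assoc, Matrix.fromBlocks_mul_fromRows, Matrix.fromCols_mul_fromRows]
    simp
  have h1 := Matrix.l2_opNorm_fromRows_one_zero_le (m := m)
  have h2 := Matrix.l2_opNorm_fromRows_zero_one_le (m := m)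
  rw [← Matrix.l2_opNorm_conjTranspose] at h1
  rw [h]
  calc _ ≤ ‖(Matrix.fromRows 1 0 : Matrix (m ⊕ m) m ℝ)ᴴ‖ * ‖X‖
          * ‖(Matrix.fromRows 0 1 : Matrix (m ⊕ m) m ℝ)‖ :=
        (Matrix.l2_opNorm_mul _ _).trans
          (mul_le_mul_of_nonneg_right (Matrix.l2_opNorm_mul _ _) (norm_nonneg _))
    _ ≤ 1 * ‖X‖ * 1 := by gcongr
    _ = ‖X‖ := by ring

/-- The block matrix `[[A, t], [0, 1]]`, whose powers contain the partial Neumann sums of `A`. -/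
def neumannBlock (t : ℝ) (A : Matrix m m ℝ) : Matrix (m ⊕ m) (m ⊕ m) ℝ :=
  Matrix.fromBlocks A (t • 1) 0 1

theorem neumannBlock_pow (t : ℝ) (A : Matrix m m ℝ) (n : ℕ) :
    neumannBlock t A ^ n = Matrix.fromBlocks (A ^ n) (t • ∑ j ∈ Finset.range n, A ^ j) 0 1 := by
  induction n with
  | zero => simp
  | succ n ih =>
    rw [pow_succ', ih, neumannBlock, Matrix.fromBlocks_multiply]
    simp [geom_sum_succ, pow_succ', smul_add]

/-- Each of the three nonzero blocks of the power has norm at most 1; the smallness of `t`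
compensates for the `n` summands of the partial sum. -/
theorem norm_neumannBlock_pow_le {A : Matrix m m ℝ} (hA : ‖A‖ ≤ 1) {t : ℝ} (ht : 0 ≤ t) {n : ℕ}
    (hn : n * t ≤ 1) : ‖neumannBlock t A ^ n‖ ≤ 3 := by
  have h1 := Matrix.l2_opNorm_pow_le_one hA n
  have h2 : ‖t • ∑ j ∈ Finset.range n, A ^ j‖ ≤ 1 := by
    rw [norm_smul, Real.norm_of_nonneg ht]
    have : ‖∑ j ∈ Finset.range n, A ^ j‖ ≤ n := by
      refine (norm_sum_le _ _).trans ?_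
      refine (Finset.sum_le_sum fun j _ => Matrix.l2_opNorm_pow_le_one hA j).trans ?_
      simp
    nlinarith
  rw [neumannBlock_pow]
  linarith [Matrix.l2_opNorm_fromBlocks_zero_one_le (A ^ n) (t • ∑ j ∈ Finset.range n, A ^ j)]

theorem norm_inv_one_sub_le {A : Matrix m m ℝ} (hA : ‖A‖ < 1) :
    ‖(1 - A)⁻¹‖ ≤ 1 / (1 - ‖A‖) := by
  have hu := (Matrix.isUnit_iff_isUnit_det _).1 (isUnit_one_sub_of_norm_lt_one hA)
  -- Taking norms in this identity bounds the inverse by itself times `‖A‖ < 1`, which can be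
  -- absorbed.
  have h : (1 - A)⁻¹ = 1 + A * (1 - A)⁻¹ := by
    have := Matrix.mul_nonsing_inv (1 - A) hu
    rw [sub_mul, one_mul] at this
    exact sub_eq_iff_eq_add.1 this
  have h2 : ‖(1 - A)⁻¹‖ ≤ 1 + ‖A‖ * ‖(1 - A)⁻¹‖ := by
    calc ‖(1 - A)⁻¹‖ = ‖1 + A * (1 - A)⁻¹‖ := by rw [← h]
      _ ≤ _ := (norm_add_le _ _).trans (add_le_add Matrix.l2_opNorm_one_le (norm_mul_le _ _))
  rw [le_div_iff₀ (by linarith)]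
  linarith

theorem norm_inv_one_sub_sub_geom_sum_le {A : Matrix m m ℝ} (hA : ‖A‖ < 1) (n : ℕ) :
    ‖(1 - A)⁻¹ - ∑ j ∈ Finset.range n, A ^ j‖ ≤ ‖A‖ ^ n / (1 - ‖A‖) := by
  have hu := (Matrix.isUnit_iff_isUnit_det _).1 (isUnit_one_sub_of_norm_lt_one hA)
  have h : (1 - A)⁻¹ - ∑ j ∈ Finset.range n, A ^ j = A ^ n * (1 - A)⁻¹ := by
    have h1 : (∑ j ∈ Finset.range n, A ^ j) = (1 - A ^ n) * (1 - A)⁻¹ := by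
      rw [← geom_sum_mul_neg A n, Matrix.mul_assoc, Matrix.mul_nonsing_inv _ hu, Matrix.mul_one]
    rw [h1, sub_mul, one_mul, sub_sub_cancel]
  rcases Nat.eq_zero_or_pos n with rfl | hn
  · simpa using norm_inv_one_sub_le hA
  · rw [h, div_eq_mul_one_div]
    exact (norm_mul_le _ _).trans (mul_le_mul (norm_pow_le' A hn) (norm_inv_one_sub_le hA)
      (norm_nonneg _) (by positivity))

end MatrixNorm

/-! ### Sawtooth iteration for `t * (1 - t)` -/

section Sawtooth

/-- The sawtooth function on the unit interval. -/
noncomputable def hat (t : ℝ) : ℝ := 2 * t - 4 * max (t - 1 / 2) 0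

theorem hat_nonneg {t : ℝ} (h0 : 0 ≤ t) (h1 : t ≤ 1) : 0 ≤ hat t := by
  rw [hat]
  rcases max_cases (t - 1 / 2) 0 with h | h <;> linarith [h.1]

theorem hat_le_one (t : ℝ) : hat t ≤ 1 := by
  rw [hat]
  rcases max_cases (t - 1 / 2) 0 with h | h <;> linarith [h.1]

/-- This self-similarity of the parabola drives the iteration: `t * (1 - t)` is a quarter of `hat t`
plus the same function at `hat t`. -/
theorem hat_add_hat_mul_one_sub_hat (t : ℝ) : hat t + hat t * (1 - hat t) = 4 * (t * (1 - t)) := by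
  rw [hat]
  rcases max_cases (t - 1 / 2) 0 with h | h <;> rw [h.1] <;> ring

variable {G : Type}

/-- The state of the sawtooth network at position `t` with accumulated value `c`. -/
noncomputable def sawtoothState (t c : G → ℝ) : G × Fin 3 → ℝ :=
  fun p => ![t p.1, relu (t p.1 - 1 / 2), c p.1] p.2

/-- One layer of the sawtooth network. -/
noncomputable def sawtoothLayer : (G × Fin 3 → ℝ) → G × Fin 3 → ℝ :=
  sparseLayer (S := Fin 3) (fun p s => (p.1, s))
    (fun p s => !![2, -4, 0; 2, -4, 0; 2, -4, 4] p.2 s) (fun p => ![0, -1 / 2, 0] p.2)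

theorem sawtoothLayer_sawtoothState {t c : G → ℝ} (h0 : ∀ g, 0 ≤ t g) (h1 : ∀ g, t g ≤ 1)
    (hc : ∀ g, 0 ≤ c g) :
    sawtoothLayer (sawtoothState t c)
      = sawtoothState (fun g => hat (t g)) (fun g => 4 * c g + hat (t g)) := by
  ext ⟨g, i⟩
  have h := hat_nonneg (h0 g) (h1 g)
  have hc := hc g
  fin_cases i
  · have : 2 * t g + -(4 * max (t g - 1 / 2) 0) = hat (t g) := by rw [hat]; ring
    simp [sawtoothLayer, sawtoothState, sparseLayer, sparseAffine, Fin.sum_univ_three, relu] at this ⊢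
    rw [this]
    exact max_eq_left h
  · have : 2 * t g + -(4 * max (t g - 1 / 2) 0) = hat (t g) := by rw [hat]; ring
    simp [sawtoothLayer, sawtoothState, sparseLayer, sparseAffine, Fin.sum_univ_three, relu] at this ⊢
    rw [this]
    congr 1
    ring
  · have : 2 * t g + -(4 * max (t g - 1 / 2) 0) = hat (t g) := by rw [hat]; ring
    simp [sawtoothLayer, sawtoothState, sparseLayer, sparseAffine, Fin.sum_univ_three, relu] at this ⊢
    rw [this, max_eq_left (by linarith)]
    ring

/-- The accumulator follows `c ↦ 4 * c + hat t`. Carrying the factor `4 ^ n` instead of dividing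
makes all layers identical, and `0 ≤ c` ensures that ReLU leaves the accumulator unchanged. -/
theorem exists_sawtoothLayer_iterate {t : G → ℝ} (h0 : ∀ g, 0 ≤ t g) (h1 : ∀ g, t g ≤ 1) (n : ℕ) :
    ∃ t' c : G → ℝ, sawtoothLayer^[n] (sawtoothState t 0) = sawtoothState t' c ∧
      ∀ g, 0 ≤ t' g ∧ t' g ≤ 1 ∧ 0 ≤ c g ∧
        c g = 4 ^ n * (t g * (1 - t g)) - t' g * (1 - t' g) := by
  induction n with
  | zero => exact ⟨t, 0, rfl, fun g => ⟨h0 g, h1 g, le_rfl, by simp⟩⟩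
  | succ n ih =>
    obtain ⟨t', c, h, hg⟩ := ih
    refine ⟨fun g => hat (t' g), fun g => 4 * c g + hat (t' g), ?_, fun g => ?_⟩
    · rw [Function.iterate_succ_apply', h]
      exact sawtoothLayer_sawtoothState (fun g => (hg g).1) (fun g => (hg g).2.1)
        fun g => (hg g).2.2.1
    · obtain ⟨ha, hb, hc, hd⟩ := hg g
      have := hat_nonneg ha hb
      refine ⟨this, hat_le_one _, by positivity, ?_⟩
      dsimp only
      rw [hd, pow_succ]
      linarith [hat_add_hat_mul_one_sub_hat (t' g)]

/-- Both remainders `t' * (1 - t')` lie in `[0, 1/4]`, hence so does the absolute value of their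
difference. -/
theorem abs_sawtoothLayer_iterate_sub_le {t : G → ℝ} (h0 : ∀ g, 0 ≤ t g) (h1 : ∀ g, t g ≤ 1)
    (n : ℕ) (g g' : G) :
    |(sawtoothLayer^[n] (sawtoothState t 0) (g, 2) - sawtoothLayer^[n] (sawtoothState t 0) (g', 2))
      - 4 ^ n * (t g * (1 - t g) - t g' * (1 - t g'))| ≤ 1 / 4 := by
  obtain ⟨t', c, h, hg⟩ := exists_sawtoothLayer_iterate h0 h1 n
  obtain ⟨ha, hb, -, hd⟩ := hg g
  obtain ⟨ha', hb', -, hd'⟩ := hg g'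
  have e1 : ∀ x, sawtoothState t' c (x, 2) = c x := fun x => rfl
  rw [h, e1, e1, hd, hd', abs_le]
  constructor <;> nlinarith [sq_nonneg (t' g - 1 / 2), sq_nonneg (t' g' - 1 / 2)]

end Sawtooth

/-! ### Approximate squaring of matrices -/

section Squaring

variable {D : Type} [Fintype D]

/-- The nonnegative encoding `X i j / B + 1` of a matrix whose entries are at most `B` in absolute
value. -/
noncomputable def encodeMatrix (B : ℝ) (X : Matrix D D ℝ) : D × D → ℝ :=
  fun p => X p.1 p.2 / B + 1

/-- The layer that computes the sums and differences of the factors `X i k` and `X k j`. -/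
noncomputable def splitLayer : (D × D → ℝ) → ((D × D × D) × Fin 2) × Fin 3 → ℝ :=
  sparseLayer (S := Fin 2)
    (fun p s => ![(p.1.1.1, p.1.1.2.1), (p.1.1.2.1, p.1.1.2.2)] s)
    (fun p s => ![![1 / 4, ![1 / 4, -1 / 4] p.1.2] s, ![1 / 4, ![1 / 4, -1 / 4] p.1.2] s, 0] p.2)
    (fun p => ![![0, 1 / 2] p.1.2, ![0, 1 / 2] p.1.2 - 1 / 2, 0] p.2)

/-- The layer that adds up the products `X i k * X k j` over `k`. -/
noncomputable def mergeLayer (a : ℝ) : (((D × D × D) × Fin 2) × Fin 3 → ℝ) → D × D → ℝ :=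
  sparseLayer (S := D × Fin 2) (fun p s => (((p.1, s.1, p.2), s.2), 2))
    (fun _ s => a * ![-1, 1] s.2) (fun _ => 1)

/-- The network block that squares a matrix, up to an error. -/
noncomputable def squareBlock (B : ℝ) (n : ℕ) : (D × D → ℝ) → D × D → ℝ :=
  mergeLayer (4 * B / 4 ^ n) ∘ sawtoothLayer^[n] ∘ splitLayer

/-- Polarization: with `u`, `v` the scaled factors, the positions are `(u ± v) / 4 + 1 / 2`. They
lie in the unit interval, and `t * (1 - t) = 1 / 4 - (t - 1 / 2) ^ 2` makes the difference `u * v /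
4`. The offsets of the encoding supply the `1 / 2` for the sum but cancel in the difference, hence
the unequal biases. -/
theorem splitLayer_encodeMatrix {D : Type} {B : ℝ} (hB : 0 < B) {X : Matrix D D ℝ} (hX : ∀ i j, |X i j| ≤ B) :
    ∃ t : (D × D × D) × Fin 2 → ℝ, (∀ g, 0 ≤ t g) ∧ (∀ g, t g ≤ 1) ∧
      splitLayer (encodeMatrix B X) = sawtoothState t 0 ∧
      ∀ i k j, t ((i, k, j), 1) * (1 - t ((i, k, j), 1)) - t ((i, k, j), 0) * (1 - t ((i, k, j), 0))
        = X i k * X k j / (4 * B ^ 2) := by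
  have hw : ∀ i j, -1 ≤ X i j / B ∧ X i j / B ≤ 1 := fun i j => by
    rw [le_div_iff₀ hB, div_le_iff₀ hB]
    have := abs_le.1 (hX i j)
    constructor <;> linarith
  refine ⟨fun g => ![(X g.1.1 g.1.2.1 / B + X g.1.2.1 g.1.2.2 / B) / 4 + 1 / 2,
    (X g.1.1 g.1.2.1 / B - X g.1.2.1 g.1.2.2 / B) / 4 + 1 / 2] g.2, ?_, ?_, ?_, ?_⟩
  · rintro ⟨⟨i, k, j⟩, σ⟩
    have h1 := hw i k
    have h2 := hw k j
    fin_cases σ <;> simp <;> linarith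
  · rintro ⟨⟨i, k, j⟩, σ⟩
    have h1 := hw i k
    have h2 := hw k j
    fin_cases σ <;> simp <;> linarith
  · ext ⟨⟨⟨i, k, j⟩, σ⟩, s⟩
    have h1 := hw i k
    have h2 := hw k j
    fin_cases σ <;> fin_cases s <;>
      simp [splitLayer, sparseLayer, sparseAffine, sawtoothState, encodeMatrix, relu,
        Fin.sum_univ_two]
    · rw [max_eq_left (by linarith)]; ring
    · congr 1; ring
    · rw [max_eq_left (by linarith)]; ring
    · congr 1; ring
  · intro i k j
    simp
    field_simp
    ring

theorem exists_squareBlock_encodeMatrix {B : ℝ} (hB : 0 < B) (n : ℕ) {X : Matrix D D ℝ}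
    (hX : ∀ i j, |X i j| ≤ B) :
    ∃ Z : Matrix D D ℝ, (∀ i j, |Z i j - (X * X) i j| ≤ Fintype.card D * (B ^ 2 / 4 ^ n)) ∧
      squareBlock B n (encodeMatrix B X) = fun p => relu (encodeMatrix B Z p) := by
  obtain ⟨t, h0, h1, hs, ht⟩ := splitLayer_encodeMatrix hB hX
  let y := sawtoothLayer^[n] (sawtoothState t 0)
  refine ⟨Matrix.of fun i j => ∑ k, 4 * B ^ 2 / 4 ^ n *
    (y (((i, k, j), 1), 2) - y (((i, k, j), 0), 2)), fun i j => ?_, ?_⟩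
  · rw [Matrix.of_apply, Matrix.mul_apply, ← Finset.sum_sub_distrib]
    refine (Finset.abs_sum_le_sum_abs _ _).trans ?_
    rw [← nsmul_eq_mul]
    refine Finset.sum_le_card_nsmul _ _ _ fun k _ => ?_
    have h := abs_sawtoothLayer_iterate_sub_le h0 h1 n ((i, k, j), 1) ((i, k, j), 0)
    rw [ht] at h
    have e : 4 * B ^ 2 / 4 ^ n * (y (((i, k, j), 1), 2) - y (((i, k, j), 0), 2)) - X i k * X k j
        = 4 * B ^ 2 / 4 ^ n * ((y (((i, k, j), 1), 2) - y (((i, k, j), 0), 2))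
          - 4 ^ n * (X i k * X k j / (4 * B ^ 2))) := by
      field_simp
    rw [e, abs_mul, abs_of_pos (by positivity)]
    calc _ ≤ 4 * B ^ 2 / 4 ^ n * (1 / 4) := by gcongr
      _ = _ := by ring
  · ext ⟨i, j⟩
    simp only [squareBlock, Function.comp_apply, hs, mergeLayer, sparseLayer, sparseAffine,
      encodeMatrix, Matrix.of_apply, Fintype.sum_prod_type, Fin.sum_univ_two, Finset.sum_div]
    congr 2
    refine Finset.sum_congr rfl fun k _ => ?_
    simp only [Matrix.cons_val_zero, Matrix.cons_val_one]
    field_simp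
    ring

theorem HasReluNetwork.comp_sawtoothLayer {G ν : Type} [Nonempty G] [Fintype G]
    {f : (G × Fin 3 → ℝ) → ν → ℝ} {L M : ℕ} (hf : HasReluNetwork f L M) :
    HasReluNetwork (f ∘ sawtoothLayer) (L + 1) (M + Fintype.card (G × Fin 3) * (3 + 1)) :=
  hf.comp_sparseLayer _ _ _

theorem HasReluNetwork.comp_splitLayer [Nonempty D] {ν : Type}
    {f : (((D × D × D) × Fin 2) × Fin 3 → ℝ) → ν → ℝ} {L M : ℕ} (hf : HasReluNetwork f L M) :
    HasReluNetwork (f ∘ splitLayer) (L + 1)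
      (M + Fintype.card (((D × D × D) × Fin 2) × Fin 3) * (2 + 1)) :=
  hf.comp_sparseLayer _ _ _

theorem HasReluNetwork.comp_mergeLayer [Nonempty D] {ν : Type} (a : ℝ)
    {f : (D × D → ℝ) → ν → ℝ} {L M : ℕ} (hf : HasReluNetwork f L M) :
    HasReluNetwork (f ∘ mergeLayer a) (L + 1)
      (M + Fintype.card (D × D) * (Fintype.card (D × Fin 2) + 1)) :=
  hf.comp_sparseLayer _ _ _

theorem HasReluNetwork.mono {ι κ : Type} {f : (ι → ℝ) → κ → ℝ} {L M L' M' : ℕ}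
    (hf : HasReluNetwork f L M) (hL : L ≤ L') (hM : M ≤ M') : HasReluNetwork f L' M' := by
  intro n k e e'
  obtain ⟨Φ, h1, h2, h3⟩ := hf n k e e'
  exact ⟨Φ, h1.trans hL, h2.trans hM, h3⟩

theorem HasReluNetwork.comp_squareBlock [Nonempty D] {ν : Type} (B : ℝ) (n : ℕ)
    {f : (D × D → ℝ) → ν → ℝ} {L M : ℕ} (hf : HasReluNetwork f L M) :
    HasReluNetwork (f ∘ squareBlock B n) (L + (n + 2))
      (M + Fintype.card D ^ 3 * (24 * n + 21)) := by
  have h := ((HasReluNetwork.comp_iterate HasReluNetwork.comp_sawtoothLayer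
    (hf.comp_mergeLayer (4 * B / 4 ^ n)) n).comp_splitLayer)
  refine HasReluNetwork.mono h (by omega) ?_
  simp only [Fintype.card_prod, Fintype.card_fin]
  have : 1 ≤ Fintype.card D := Fintype.card_pos
  nlinarith [Nat.mul_le_mul_left (Fintype.card D * Fintype.card D) this]

end Squaring

/-! ### Error propagation under repeated squaring -/

theorem squareBlock_encodeMatrix_of_norm_le {D : Type} [Fintype D] [DecidableEq D] (n : ℕ)
    {X : Matrix D D ℝ} (hX : ‖X‖ ≤ 4) :
    ∃ Z : Matrix D D ℝ, ‖Z - X * X‖ ≤ 16 * (Fintype.card D : ℝ) ^ 3 / 4 ^ n ∧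
      (‖Z‖ ≤ 4 → squareBlock 4 n (encodeMatrix 4 X) = encodeMatrix 4 Z) := by
  obtain ⟨Z, hZ, h⟩ := exists_squareBlock_encodeMatrix (B := 4) (by norm_num) n
    fun i j => (Matrix.abs_apply_le_l2_opNorm X i j).trans hX
  refine ⟨Z, (Matrix.l2_opNorm_le_of_abs_le (Z - X * X) hZ).trans (le_of_eq (by ring)),
    fun hZ4 => ?_⟩
  rw [h]
  ext ⟨i, j⟩
  have := abs_le.1 ((Matrix.abs_apply_le_l2_opNorm Z i j).trans hZ4)
  exact max_eq_left (by simp only [encodeMatrix]; linarith)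

/-- While the error is at most 1, the approximation has norm at most 4, so its encoding is
nonnegative and the next block applies. -/
theorem exists_squareBlock_iterate {D : Type} [Fintype D] [DecidableEq D] (n : ℕ)
    {X : Matrix D D ℝ} {η : ℝ} (hη : 16 * (Fintype.card D : ℝ) ^ 3 / 4 ^ n ≤ η) (K : ℕ)
    (hX : ∀ k ≤ K, ‖X ^ 2 ^ k‖ ≤ 3) (hK : 8 ^ K * η ≤ 1) :
    ∃ Z : Matrix D D ℝ, (squareBlock 4 n)^[K] (encodeMatrix 4 X) = encodeMatrix 4 Z ∧
      ‖Z - X ^ 2 ^ K‖ ≤ (8 ^ K - 1) * η := by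
  have hη0 : 0 ≤ η := le_trans (by positivity) hη
  induction K with
  | zero => exact ⟨X, rfl, by simp⟩
  | succ K ih =>
    have h8 : 8 ^ K * η ≤ 1 := by
      rw [pow_succ] at hK
      have : 0 ≤ 8 ^ K * η := by positivity
      linarith
    obtain ⟨Y, hY, hYX⟩ := ih (fun k hk => hX k (hk.trans (Nat.le_succ K))) h8
    have hP := hX K (Nat.le_succ K)
    have hP' := hX (K + 1) le_rfl
    set P := X ^ 2 ^ K with hPdef
    have hPP : X ^ 2 ^ (K + 1) = P * P := by rw [hPdef, ← pow_add, ← two_mul, ← pow_succ']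
    have he : ‖Y - P‖ ≤ 1 := hYX.trans (by linarith)
    have hY4 : ‖Y‖ ≤ 4 := by
      have := norm_add_le (Y - P) P
      rw [sub_add_cancel] at this
      linarith
    obtain ⟨Z, hZ, hZ'⟩ := squareBlock_encodeMatrix_of_norm_le n hY4
    -- The factor 7 is `‖Y‖ + ‖P‖ ≤ 4 + 3`; adding the fresh error `η` gives `7 * (8 ^ K - 1) * η +
    -- η ≤ (8 ^ (K + 1) - 1) * η`.
    have hYP : ‖Y * Y - P * P‖ ≤ 7 * ‖Y - P‖ := by
      have : Y * Y - P * P = Y * (Y - P) + (Y - P) * P := by noncomm_ring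
      rw [this]
      calc _ ≤ ‖Y‖ * ‖Y - P‖ + ‖Y - P‖ * ‖P‖ :=
            (norm_add_le _ _).trans (add_le_add (norm_mul_le _ _) (norm_mul_le _ _))
        _ ≤ 4 * ‖Y - P‖ + ‖Y - P‖ * 3 := by gcongr
        _ = _ := by ring
    have hfin : ‖Z - P * P‖ ≤ (8 ^ (K + 1) - 1) * η := by
      have h1 := norm_add_le (Z - Y * Y) (Y * Y - P * P)
      rw [sub_add_sub_cancel] at h1
      have : 0 ≤ 8 ^ K * η := by positivity
      rw [pow_succ]
      linarith
    refine ⟨Z, ?_, hPP ▸ hfin⟩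
    rw [Function.iterate_succ_apply', hY]
    refine hZ' ?_
    have h1 := norm_add_le (Z - P * P) (P * P)
    rw [sub_add_cancel] at h1
    rw [hPP] at hP'
    linarith

/-! ### The network for the partial Neumann sum -/

/-- The layer that encodes the block matrix `[[A, t], [0, 1]]`. -/
noncomputable def neumannInput (d : ℕ) (t : ℝ) :
    (Fin d × Fin d → ℝ) → (Fin d ⊕ Fin d) × (Fin d ⊕ Fin d) → ℝ :=
  sparseLayer (S := Unit) (fun p _ => (Sum.elim id id p.1, Sum.elim id id p.2))
    (fun p _ => Sum.elim (fun _ => Sum.elim (fun _ => 1 / 4) (fun _ => 0) p.2) (fun _ => 0) p.1)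
    (encodeMatrix 4 (neumannBlock t 0))

/-- The affine map that reads off `s` times the upper right block of an encoded matrix. -/
noncomputable def neumannOutput (d : ℕ) (s : ℝ) :
    ((Fin d ⊕ Fin d) × (Fin d ⊕ Fin d) → ℝ) → Fin d × Fin d → ℝ :=
  sparseAffine (S := Unit) (fun p _ => (Sum.inl p.1, Sum.inr p.2)) (fun _ _ => 4 * s)
    (fun _ => -(4 * s))

theorem neumannInput_apply {d : ℕ} {t : ℝ} {A : Matrix (Fin d) (Fin d) ℝ}
    (h : ‖neumannBlock t A‖ ≤ 4) :
    neumannInput d t (fun p => A p.1 p.2) = encodeMatrix 4 (neumannBlock t A) := by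
  ext ⟨i, j⟩
  have := abs_le.1 ((Matrix.abs_apply_le_l2_opNorm _ i j).trans h)
  have e : neumannInput d t (fun p => A p.1 p.2) (i, j)
      = max (encodeMatrix 4 (neumannBlock t A) (i, j)) 0 := by
    rcases i with i | i <;> rcases j with j | j <;>
      simp [neumannInput, sparseLayer, sparseAffine, encodeMatrix, neumannBlock, relu]
    rw [div_eq_inv_mul]
  rw [e]
  exact max_eq_left (by simp only [encodeMatrix]; linarith)

theorem neumannOutput_encodeMatrix {d : ℕ} (s : ℝ)
    (Z : Matrix (Fin d ⊕ Fin d) (Fin d ⊕ Fin d) ℝ) :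
    neumannOutput d s (encodeMatrix 4 Z) = fun p => (s • Z.toBlocks₁₂) p.1 p.2 := by
  ext ⟨i, j⟩
  simp [neumannOutput, sparseAffine, encodeMatrix, Matrix.toBlocks₁₂]
  ring

/-- The function realized by the network that approximates a partial Neumann sum. -/
noncomputable def neumannFunction (d K n : ℕ) : (Fin d × Fin d → ℝ) → Fin d × Fin d → ℝ :=
  (neumannOutput d (2 ^ K) ∘ (squareBlock 4 n)^[K]) ∘ neumannInput d (1 / 2 ^ K)

theorem hasReluNetwork_neumannFunction {d : ℕ} (hd : 1 ≤ d) (K n : ℕ) :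
    HasReluNetwork (neumannFunction d K n) (K * (n + 2) + 2)
      (10 * d ^ 2 + K * (8 * d ^ 3 * (24 * n + 21))) := by
  have : Nonempty (Fin d) := ⟨⟨0, hd⟩⟩
  have h0 : HasReluNetwork (neumannOutput d (2 ^ K)) 1 _ := hasReluNetwork_sparseAffine _ _ _
  have h1 := HasReluNetwork.comp_iterate (HasReluNetwork.comp_squareBlock 4 n) h0 K
  have h2 : HasReluNetwork (neumannFunction d K n) _ _ := h1.comp_sparseLayer _ _ _
  refine h2.mono (by omega) (le_of_eq ?_)
  simp only [Fintype.card_prod, Fintype.card_sum, Fintype.card_fin, Fintype.card_unit]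
  ring

/-- The constant 128 is `16 * 2 ^ 3`, as the block matrix has size `2 * d`; the final rescaling by
`2 ^ K` turns `8 ^ K` into `16 ^ K`. -/
theorem norm_neumannFunction_sub_le {d K n : ℕ} {η : ℝ} (hη : 128 * (d : ℝ) ^ 3 / 4 ^ n ≤ η)
    (hK : 8 ^ K * η ≤ 1) {A : Matrix (Fin d) (Fin d) ℝ} (hA : ‖A‖ ≤ 1) :
    ‖Matrix.of (fun i j => neumannFunction d K n (fun p => A p.1 p.2) (i, j))
      - ∑ j ∈ Finset.range (2 ^ K), A ^ j‖ ≤ 16 ^ K * η := by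
  have hη0 : 0 ≤ η := le_trans (by positivity) hη
  have hb : ∀ k ≤ K, ‖neumannBlock (1 / 2 ^ K) A ^ 2 ^ k‖ ≤ 3 := fun k hk => by
    refine norm_neumannBlock_pow_le hA (by positivity) ?_
    rw [mul_one_div, div_le_one (by positivity)]
    push_cast
    exact pow_le_pow_right₀ (by norm_num) hk
  have hη' : 16 * (Fintype.card (Fin d ⊕ Fin d) : ℝ) ^ 3 / 4 ^ n ≤ η := by
    refine le_trans (le_of_eq ?_) hη
    simp only [Fintype.card_sum, Fintype.card_fin]
    push_cast
    ring
  obtain ⟨Z, hZ, hZX⟩ := exists_squareBlock_iterate n hη' K hb hK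
  have h0 : ‖neumannBlock (1 / 2 ^ K) A‖ ≤ 4 := by
    have := hb 0 (Nat.zero_le K)
    rw [pow_zero, pow_one] at this
    linarith
  have hF : Matrix.of (fun i j => neumannFunction d K n (fun p => A p.1 p.2) (i, j))
      = (2 ^ K : ℝ) • Z.toBlocks₁₂ := by
    ext i j
    simp only [neumannFunction, Function.comp_apply, neumannInput_apply h0, hZ,
      neumannOutput_encodeMatrix, Matrix.of_apply]
  have hS : ∑ j ∈ Finset.range (2 ^ K), A ^ j
      = (2 ^ K : ℝ) • (neumannBlock (1 / 2 ^ K) A ^ 2 ^ K).toBlocks₁₂ := by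
    rw [neumannBlock_pow, Matrix.toBlocks_fromBlocks₁₂, smul_smul, mul_one_div, div_self
      (by positivity), one_smul]
  have hsub : (2 ^ K : ℝ) • Z.toBlocks₁₂
      - (2 ^ K : ℝ) • (neumannBlock (1 / 2 ^ K) A ^ 2 ^ K).toBlocks₁₂
      = (2 ^ K : ℝ) • (Z - neumannBlock (1 / 2 ^ K) A ^ 2 ^ K).toBlocks₁₂ := by
    rw [← smul_sub]
    rfl
  rw [hF, hS, hsub, norm_smul, Real.norm_of_nonneg (by positivity)]
  calc _ ≤ 2 ^ K * ((8 ^ K - 1) * η) := by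
        gcongr
        exact (Matrix.l2_opNorm_toBlocks₁₂_le _).trans hZX
    _ ≤ 2 ^ K * (8 ^ K * η) := by gcongr; linarith
    _ = 16 ^ K * η := by rw [← mul_assoc, ← mul_pow]; norm_num

/-! ### Choice of parameters and the main theorem -/

theorem pow_div_le_of_neumannLength_add_one_le {ε δ : ℝ} (hε : 0 < ε) (hδ : 0 < δ) (hδ1 : δ < 1) {N : ℕ}
    (hN : (neumannLength ε δ : ℝ) + 1 ≤ N) : (1 - δ) ^ N / δ ≤ ε / 2 := by
  have hl : Real.logb 2 (1 - δ) < 0 := Real.logb_neg (by norm_num) (by linarith) (by linarith)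
  have h1 : Real.logb 2 (0.5 * ε * δ) / Real.logb 2 (1 - δ) ≤ N := by
    refine (Int.le_ceil _).trans (le_trans (le_of_eq ?_) hN)
    rw [neumannLength]
    push_cast
    ring
  rw [div_le_iff_of_neg hl, ← Real.logb_pow,
    Real.logb_le_logb (by norm_num) (pow_pos (by linarith) N) (by positivity)] at h1
  rw [div_le_iff₀ hδ]
  linarith

theorem le_two_pow_ceil_logb {x : ℝ} (hx : 0 < x) : x ≤ 2 ^ ⌈Real.logb 2 x⌉₊ := by
  rw [← Real.rpow_natCast, ← Real.logb_le_iff_le_rpow (by norm_num) hx]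
  exact Nat.le_ceil _

theorem mainTheorem1 :
    ∃ C : ℝ, 0 < C ∧
      ∀ d : ℕ, 1 ≤ d → ∀ ε : ℝ, 0 < ε → ε < 1 / 4 → ∀ δ : ℝ, 0 < δ → δ < 1 →
        ∃ Φ : NeuralNetwork (d * d) (d * d),
          (Φ.numLayers : ℝ) ≤
            C * Real.logb 2 (max (neumannLength ε δ : ℝ) 2)
              * (Real.logb 2 (1 / ε) + Real.logb 2 (max (neumannLength ε δ : ℝ) 2)
                  + Real.logb 2 (d : ℝ)) ∧
          (Φ.numWeights : ℝ) ≤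
            C * max (neumannLength ε δ : ℝ) 2
              * Real.logb 2 (max (neumannLength ε δ : ℝ) 2) ^ 2 * (d : ℝ) ^ 3
              * (Real.logb 2 (1 / ε) + Real.logb 2 (max (neumannLength ε δ : ℝ) 2)
                  + Real.logb 2 (d : ℝ)) ∧
          ∀ A : Matrix (Fin d) (Fin d) ℝ, ‖A‖ ≤ 1 - δ →
            IsUnit (1 - A) ∧
            ‖(1 - A)⁻¹ - matrOfVec (Φ.realize relu (vecMatrix A))‖ ≤ ε ∧
            ‖matrOfVec (Φ.realize relu (vecMatrix A))‖ ≤ ε + ‖(1 - A)⁻¹‖ ∧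
            ε + ‖(1 - A)⁻¹‖ ≤ ε + 1 / (1 - ‖A‖) ∧
            ε + 1 / (1 - ‖A‖) ≤ ε + 1 / δ := by
  refine ⟨10000, by norm_num, fun d hd ε hε hε4 δ hδ hδ1 => ?_⟩
  set m : ℝ := max (neumannLength ε δ : ℝ) 2 with hm
  set μ : ℝ := Real.logb 2 m with hμ
  set E : ℝ := Real.logb 2 (1 / ε) with hE
  set l : ℝ := Real.logb 2 (d : ℝ) with hl
  have hm2 : 2 ≤ m := le_max_right _ _
  have hmN : (neumannLength ε δ : ℝ) ≤ m := le_max_left _ _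
  have hd1 : (1 : ℝ) ≤ d := by exact_mod_cast hd
  have hμ1 : 1 ≤ μ := by
    rw [hμ, Real.le_logb_iff_rpow_le (by norm_num) (by linarith)]
    simpa using hm2
  have hl0 : 0 ≤ l := Real.logb_nonneg (by norm_num) hd1
  have hE0 : 0 ≤ E := Real.logb_nonneg (by norm_num) (by rw [le_div_iff₀ hε]; linarith)
  -- The extra 1 gives `2 ^ K ≥ 2 * m ≥ m + 1`, enough terms for a truncation error of `ε / 2`.
  obtain ⟨K, hK⟩ : ∃ K : ℕ, K = ⌈μ⌉₊ + 1 := ⟨_, rfl⟩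
  -- Chosen so that `4 ^ n` dominates `2 * 128 * 16 ^ K * d ^ 3 / ε`, which leaves `ε / 2` for the
  -- network error.
  obtain ⟨n, hn⟩ : ∃ n : ℕ, n = 4 + 2 * K + 2 * ⌈l⌉₊ + ⌈E⌉₊ := ⟨_, rfl⟩
  have hKμ : (K : ℝ) ≤ 3 * μ := by
    have := Nat.ceil_lt_add_one (zero_le_one.trans hμ1)
    rw [hK]
    push_cast
    linarith
  have hnX : (n : ℝ) + 2 ≤ 15 * (E + μ + l) := by
    have h1 := Nat.ceil_lt_add_one hl0
    have h2 := Nat.ceil_lt_add_one hE0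
    rw [hn]
    push_cast
    linarith
  have hmK : m + 1 ≤ 2 ^ K := by
    have := le_two_pow_ceil_logb (show 0 < m by linarith)
    rw [hK, pow_succ]
    linarith
  set η : ℝ := 128 * (d : ℝ) ^ 3 / 4 ^ n with hη
  have h16 : 16 ^ K * η ≤ ε / 2 := by
    have hd3 : (d : ℝ) ^ 3 ≤ 16 ^ ⌈l⌉₊ := by
      have : (d : ℝ) ≤ 2 ^ ⌈l⌉₊ := le_two_pow_ceil_logb (by linarith)
      calc (d : ℝ) ^ 3 ≤ (d : ℝ) ^ 4 := pow_le_pow_right₀ hd1 (by norm_num)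
        _ ≤ (2 ^ ⌈l⌉₊) ^ 4 := by gcongr
        _ = 16 ^ ⌈l⌉₊ := by rw [← pow_mul, mul_comm, pow_mul]; norm_num
    have hε' : 1 / ε ≤ 4 ^ ⌈E⌉₊ :=
      (le_two_pow_ceil_logb (by positivity)).trans (by gcongr; norm_num)
    rw [div_le_iff₀ hε] at hε'
    have h4 : (4 : ℝ) ^ n = 256 * 16 ^ K * 16 ^ ⌈l⌉₊ * 4 ^ ⌈E⌉₊ := by
      rw [hn, pow_add, pow_add, pow_add, pow_mul, pow_mul]
      norm_num
    rw [hη, ← mul_div_assoc, div_le_iff₀ (by positivity), h4]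
    calc (16 : ℝ) ^ K * (128 * (d : ℝ) ^ 3) ≤ 16 ^ K * (128 * 16 ^ ⌈l⌉₊) * 1 := by
          rw [mul_one]; gcongr
      _ ≤ 16 ^ K * (128 * 16 ^ ⌈l⌉₊) * (4 ^ ⌈E⌉₊ * ε) := by gcongr
      _ = _ := by ring
  have h8 : 8 ^ K * η ≤ 1 := by
    have : (8 : ℝ) ^ K * η ≤ 16 ^ K * η := by gcongr; norm_num
    linarith
  let e : Fin d × Fin d ≃ Fin (d * d) := (Equiv.prodComm _ _).trans finProdFinEquiv
  obtain ⟨Φ, hL, hM, hΦ⟩ := hasReluNetwork_neumannFunction hd K n (d * d) (d * d) e e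
  refine ⟨Φ, ?_, ?_, fun A hA => ?_⟩
  · have hX : 1 ≤ E + μ + l := by linarith
    calc (Φ.numLayers : ℝ) ≤ K * (n + 2) + 2 := by exact_mod_cast hL
      _ ≤ 3 * μ * (15 * (E + μ + l)) + 2 * (μ * (E + μ + l)) := by
          gcongr
          nlinarith
      _ = 47 * (μ * (E + μ + l)) := by ring
      _ ≤ 10000 * (μ * (E + μ + l)) := by gcongr; norm_num
      _ = _ := by ring
  · have hX : 1 ≤ E + μ + l := by linarith
    have hd23 : (d : ℝ) ^ 2 ≤ (d : ℝ) ^ 3 := pow_le_pow_right₀ hd1 (by norm_num)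
    calc (Φ.numWeights : ℝ) ≤ 10 * (d : ℝ) ^ 2 + K * (8 * (d : ℝ) ^ 3 * (24 * n + 21)) := by
          exact_mod_cast hM
      _ ≤ 10 * (d : ℝ) ^ 3 * (μ * (E + μ + l))
          + 3 * μ * (8 * (d : ℝ) ^ 3 * (24 * (15 * (E + μ + l)))) := by
          have h1 : (24 : ℝ) * n + 21 ≤ 24 * (15 * (E + μ + l)) := by linarith
          have h2 : 1 ≤ μ * (E + μ + l) := one_le_mul_of_one_le_of_one_le hμ1 hX
          have h3 : 10 * (d : ℝ) ^ 2 ≤ 10 * (d : ℝ) ^ 3 * (μ * (E + μ + l)) := by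
            have : 0 ≤ (d : ℝ) ^ 3 := by positivity
            nlinarith
          gcongr
      _ = 8650 * (μ * ((d : ℝ) ^ 3 * (E + μ + l))) := by ring
      _ ≤ 10000 * ((m * μ ^ 2) * ((d : ℝ) ^ 3 * (E + μ + l))) := by
          -- Repeated squaring needs only about `μ` matrix products, so the factor `m * μ` of the
          -- claimed bound is slack.
          have : μ ≤ m * μ ^ 2 := by nlinarith
          gcongr
          norm_num
      _ = _ := by ring
  · have hA1 : ‖A‖ < 1 := by linarith
    have hv : vecMatrix A = (fun p : Fin d × Fin d => A p.1 p.2) ∘ e.symm := rfl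
    have hout : matrOfVec (Φ.realize relu (vecMatrix A))
        = Matrix.of fun i j => neumannFunction d K n (fun p => A p.1 p.2) (i, j) := by
      rw [hv, hΦ]
      ext i j
      change neumannFunction d K n _ (e.symm (e (i, j))) = _
      rw [Equiv.symm_apply_apply]
      rfl
    have h1 := norm_neumannFunction_sub_le le_rfl h8 hA1.le
    have h2 := norm_inv_one_sub_sub_geom_sum_le hA1 (2 ^ K)
    have h3 : ‖A‖ ^ 2 ^ K / (1 - ‖A‖) ≤ ε / 2 := by
      refine le_trans ?_ (pow_div_le_of_neumannLength_add_one_le hε hδ hδ1 (N := 2 ^ K) ?_)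
      · gcongr
        linarith
      · push_cast
        linarith
    have hmain : ‖(1 - A)⁻¹ - matrOfVec (Φ.realize relu (vecMatrix A))‖ ≤ ε := by
      rw [hout]
      have := norm_sub_le_norm_sub_add_norm_sub (1 - A)⁻¹ (∑ j ∈ Finset.range (2 ^ K), A ^ j)
        (Matrix.of fun i j => neumannFunction d K n (fun p => A p.1 p.2) (i, j))
      rw [norm_sub_rev (Finset.sum _ _)] at this
      linarith
    refine ⟨isUnit_one_sub_of_norm_lt_one hA1, hmain, ?_,
      add_le_add_right (norm_inv_one_sub_le hA1) ε, ?_⟩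
    · have := norm_sub_norm_le (matrOfVec (Φ.realize relu (vecMatrix A))) (1 - A)⁻¹
      rw [norm_sub_rev] at this
      linarith
    · gcongr
      linarith
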